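/- Let $A=(A_1,A_2,\dots)$ be an infinite sequence of rectangles, $A_i$ of size $w_i\times l_i$, with $0<w_i\le l_i$ and $l_{i+1}\le l_i$ for all $i$, and $\sum_{i\ge1}l_i^2<\infty$. A positioning $P$ of a (finite or infinite) family of such rectangles places them in the coordinate plane with pairwise disjoint interiors, each $A_i$ being a translate of $[0,w_i]\times[0,l_i]$ (no rotation). If $A_i$ is placed at $[x_i^-,x_i^+]\times[y_i^-,y_i^+]$, put $p(P)=\sup_{i,j}(x_i^+-x_j^-)$, $q(P)=\sup_{i,j}(y_i^+-y_j^-)$ and, when both are finite, $T(P)=p(P)\,q(P)$ and $\eta(P)=S/T(P)$, where $S$ is the total area of the rectangles of the family. Let $\eta_0=\sup\eta(P)$ and $T_0=\inf T(P)$, over all positionings $P$ with $p(P),q(P)<\infty$; $P$ is called optimal if $\eta(P)=\eta_0$. Let $A^n=(A_1,\dots,A_n)$ and $R_n=\sum_{k>n}l_k^2$. Then $\eta_0(A)$ is well defined: $S(A)<\infty$, there are positionings of $A$ with $p,q<\infty$, the supremum $\eta_0(A)$ and the infimum $T_0(A)$ are finite and attained, and every optimal positioning of $A$ has bounding area $T_0(A)$;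 the same holds for each $A^n$, $n\ge1$. Moreover $$\eta_0(A^n)\to\eta_0(A)\qquad(n\to\infty),$$ $T_0(A^n)\le T_0(A)$ for all $n\ge1$, and $$T_0(A)-T_0(A^n)\le \frac{T_0(A^n)\sqrt{R_n}}{w_1}$$ for all sufficiently large $n$; more precisely, this bound holds for every $n\ge1$ such that some optimal positioning $P$ of $A^n$ has $q(P)\ge4\sqrt{R_n}$. -/

import Mathlib

open Set Filter Topology

noncomputable section

/-- A family of rectangles indexed by `ι`: the `i`-th one has size `w i × l i`, as an ordered pair
(`w i` is the horizontal side and `l i` the vertical one). -/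
structure RectFamily (ι : Type) where
  w : ι → ℝ
  l : ι → ℝ
  w_pos : ∀ i, 0 < w i
  l_pos : ∀ i, 0 < l i

namespace RectFamily

variable {ι : Type}

/-- The total area `S(A)`. -/
def totalArea (A : RectFamily ι) : ℝ := ∑' i, A.w i * A.l i

/-- The first `n` rectangles of a sequence of rectangles. -/
def initial (A : RectFamily ℕ) (n : ℕ) : RectFamily (Fin n) where
  w i := A.w i
  l i := A.l i
  w_pos i := A.w_pos i
  l_pos i := A.l_pos i

/-- The tail sum of the squares of the `l`-sides of the rectangles that remain after the
first `n`. -/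
def tailSq (A : RectFamily ℕ) (n : ℕ) : ℝ := ∑' k, A.l (n + k) ^ 2

/-- A positioning of `A` in the coordinate plane: `(x i, y i)` is the lower left corner of the
`i`-th rectangle, and the interiors of different rectangles do not overlap. -/
structure Positioning (A : RectFamily ι) where
  x : ι → ℝ
  y : ι → ℝ
  disjoint_interior : ∀ i j, i ≠ j →
    Disjoint (interior (Icc (x i) (x i + A.w i) ×ˢ Icc (y i) (y i + A.l i)))
      (interior (Icc (x j) (x j + A.w j) ×ˢ Icc (y j) (y j + A.l j)))

namespace Positioning

variable {A : RectFamily ι}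

/-- The positioning has finite extent in both directions (always so for finitely many
rectangles); `p`, `q`, `area` and `efficiency` below are only meaningful in this case. -/
def IsBounded (P : Positioning A) : Prop :=
  BddAbove (range fun ij : ι × ι => (P.x ij.1 + A.w ij.1) - P.x ij.2) ∧
    BddAbove (range fun ij : ι × ι => (P.y ij.1 + A.l ij.1) - P.y ij.2)

/-- The width of the bounding box. -/
def p (P : Positioning A) : ℝ := ⨆ ij : ι × ι, ((P.x ij.1 + A.w ij.1) - P.x ij.2)

/-- The height of the bounding box. -/
def q (P : Positioning A) : ℝ := ⨆ ij : ι × ι, ((P.y ij.1 + A.l ij.1) - P.y ij.2)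

/-- The bounding area `T`. -/
def area (P : Positioning A) : ℝ := P.p * P.q

/-- The packing efficiency `η`. -/
def efficiency (P : Positioning A) : ℝ := A.totalArea / P.area

end Positioning

/-- The packing efficiencies of all positionings of `A` of finite extent. -/
def efficiencies (A : RectFamily ι) : Set ℝ :=
  {e | ∃ P : Positioning A, P.IsBounded ∧ P.efficiency = e}

/-- The bounding areas of all positionings of `A` of finite extent. -/
def areas (A : RectFamily ι) : Set ℝ :=
  {t | ∃ P : Positioning A, P.IsBounded ∧ P.area = t}

/-- The best packing efficiency `η₀(A)`. -/
def bestEfficiency (A : RectFamily ι) : ℝ := sSup A.efficiencies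

/-- The optimal bounding area `T₀(A)`. -/
def bestArea (A : RectFamily ι) : ℝ := sInf A.areas

/-- A positioning with the best packing efficiency. -/
def Positioning.IsOptimal {A : RectFamily ι} (P : Positioning A) : Prop :=
  P.IsBounded ∧ P.efficiency = A.bestEfficiency

end RectFamily

end

/-!
Write `η₀ = S / T₀`: everything reduces to the least bounding area.  A positioning of finite extent
with bounding box `a × b` is the same, up to a translation, as a choice of lower left corners in
the box `[0, a] × [0, b]` such that any two rectangles are separated by a vertical or a horizontal
line (`PacksIn`).

* *Attainment.*  Both sides of the box are bounded below by the sides of any one rectangle, so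
  boxes of bounded area have bounded sides.  Corners and box sides thus range over a compact subset
  of a product of intervals (Tychonoff; the separation conditions are closed), and the continuous
  function `a * b` has a minimum there (`PacksIn.exists_min`).
* *The remaining rectangles.*  Squares of decreasing sides `s k` with total area `R` are packed
  greedily on shelves of width `√R`.  When a shelf is closed, its squares together with the next
  one have total width more than `√R`, which pays for the height of the next shelf; so the shelves
  have total height at most `s 0 + 2 √R ≤ 3 √R` (`exists_square_packing`).  In particular the whole
  family has a positioning of finite extent.
* *Error bound.*  Given an optimal box `p × q` of the first `n` rectangles with `4 √Rₙ ≤ q`,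
  the others fit into a strip `√Rₙ × q` beside it, so `T₀(A) ≤ p q + √Rₙ q`, and `w 0 ≤ p`
  (`PacksIn.extend`).  As `l 0 ≤ q` and `Rₙ → 0`, this applies to all large `n`; together with
  `T₀(Aⁿ) ≤ T₀(A)` it gives `T₀(Aⁿ) → T₀(A)`, hence the convergence of the efficiencies.
-/

namespace RectFamily

variable {ι : Type} {A : RectFamily ι} {a b : ℝ}

/-! ### Packings in a box -/

/-- Rectangles with lower left corners `(x i, y i)` are pairwise separated by a vertical or a
horizontal line; see `disjoint_interior_iff`. -/
def Separated (A : RectFamily ι) (x y : ι → ℝ) : Prop :=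
  ∀ i j, i ≠ j → (x i + A.w i ≤ x j ∨ x j + A.w j ≤ x i) ∨
    (y i + A.l i ≤ y j ∨ y j + A.l j ≤ y i)

/-- The rectangles with lower left corners `(x i, y i)` lie in `[0, a] × [0, b]`. -/
def InBox (A : RectFamily ι) (x y : ι → ℝ) (a b : ℝ) : Prop :=
  ∀ i, (0 ≤ x i ∧ x i + A.w i ≤ a) ∧ (0 ≤ y i ∧ y i + A.l i ≤ b)

/-- The family can be placed in the box `[0, a] × [0, b]` without overlap of interiors. -/
def PacksIn (A : RectFamily ι) (a b : ℝ) : Prop :=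
  ∃ x y : ι → ℝ, A.InBox x y a b ∧ A.Separated x y

lemma disjoint_Ioo_iff {x y u v : ℝ} (hu : 0 < u) (hv : 0 < v) :
    Disjoint (Ioo x (x + u)) (Ioo y (y + v)) ↔ x + u ≤ y ∨ y + v ≤ x := by
  rw [Set.Ioo_disjoint_Ioo, min_le_iff, le_max_iff, le_max_iff]
  constructor
  · rintro ((h | h) | (h | h))
    · linarith
    · exact Or.inl h
    · exact Or.inr h
    · linarith
  · rintro (h | h)
    · exact Or.inl (Or.inr h)
    · exact Or.inr (Or.inl h)

lemma disjoint_interior_iff (A : RectFamily ι) (x y : ι → ℝ) (i j : ι) :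
    Disjoint (interior (Icc (x i) (x i + A.w i) ×ˢ Icc (y i) (y i + A.l i)))
      (interior (Icc (x j) (x j + A.w j) ×ˢ Icc (y j) (y j + A.l j))) ↔
    (x i + A.w i ≤ x j ∨ x j + A.w j ≤ x i) ∨ (y i + A.l i ≤ y j ∨ y j + A.l j ≤ y i) := by
  simp only [interior_prod_eq, interior_Icc]
  rw [Set.disjoint_prod, disjoint_Ioo_iff (A.w_pos i) (A.w_pos j),
    disjoint_Ioo_iff (A.l_pos i) (A.l_pos j)]

lemma PacksIn.w_le (h : A.PacksIn a b) (i : ι) : A.w i ≤ a := by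
  obtain ⟨x, y, hb, -⟩ := h
  linarith [(hb i).1.1, (hb i).1.2]

lemma PacksIn.l_le (h : A.PacksIn a b) (i : ι) : A.l i ≤ b := by
  obtain ⟨x, y, hb, -⟩ := h
  linarith [(hb i).2.1, (hb i).2.2]

/-- Translates `f i` to `f i - ⨅ j, f j`, which is non-negative and stays within the extent of the
family in this direction. -/
lemma sub_iInf_bounds {f s : ι → ℝ}
    (h : BddAbove (range fun ij : ι × ι => (f ij.1 + s ij.1) - f ij.2)) (i : ι) :
    0 ≤ f i - ⨅ j, f j ∧
      f i - (⨅ j, f j) + s i ≤ ⨆ ij : ι × ι, ((f ij.1 + s ij.1) - f ij.2) := by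
  have : Nonempty ι := ⟨i⟩
  have key : ∀ j, f i + s i - (⨆ ij : ι × ι, ((f ij.1 + s ij.1) - f ij.2)) ≤ f j := fun j => by
    linarith [le_ciSup h (i, j)]
  have h1 : ⨅ j, f j ≤ f i := ciInf_le ⟨_, by rintro _ ⟨j, rfl⟩; exact key j⟩ i
  have h2 := le_ciInf key
  constructor <;> linarith

lemma Positioning.IsBounded.packsIn {P : A.Positioning} (h : P.IsBounded) :
    A.PacksIn P.p P.q := by
  refine ⟨fun i => P.x i - ⨅ j, P.x j, fun i => P.y i - ⨅ j, P.y j,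
    fun i => ⟨sub_iInf_bounds h.1 i, sub_iInf_bounds h.2 i⟩, fun i j hij => ?_⟩
  rcases (disjoint_interior_iff A P.x P.y i j).1 (P.disjoint_interior i j hij) with
    (h | h) | (h | h)
  · exact Or.inl (Or.inl (by linarith))
  · exact Or.inl (Or.inr (by linarith))
  · exact Or.inr (Or.inl (by linarith))
  · exact Or.inr (Or.inr (by linarith))

lemma PacksIn.exists_positioning [Nonempty ι] (h : A.PacksIn a b) :
    ∃ P : A.Positioning, P.IsBounded ∧ P.p ≤ a ∧ P.q ≤ b := by
  obtain ⟨x, y, hb, hs⟩ := h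
  have hx : ∀ ij : ι × ι, (x ij.1 + A.w ij.1) - x ij.2 ≤ a := fun ij => by
    linarith [(hb ij.1).1.2, (hb ij.2).1.1]
  have hy : ∀ ij : ι × ι, (y ij.1 + A.l ij.1) - y ij.2 ≤ b := fun ij => by
    linarith [(hb ij.1).2.2, (hb ij.2).2.1]
  exact ⟨⟨x, y, fun i j hij => (disjoint_interior_iff A x y i j).2 (hs i j hij)⟩,
    ⟨⟨a, by rintro _ ⟨ij, rfl⟩; exact hx ij⟩, ⟨b, by rintro _ ⟨ij, rfl⟩; exact hy ij⟩⟩,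
    ciSup_le hx, ciSup_le hy⟩

/-! ### Existence of optimal packings -/

lemma isClosed_separated (A : RectFamily ι) :
    IsClosed {z : (ι → ℝ) × (ι → ℝ) × ℝ × ℝ | A.Separated z.1 z.2.1} := by
  simp only [Separated, ofPred_forall, ofPred_or]
  refine isClosed_iInter fun i => isClosed_iInter fun j => isClosed_iInter fun _ => ?_
  exact ((isClosed_le (by fun_prop) (by fun_prop)).union
    (isClosed_le (by fun_prop) (by fun_prop))).union
    ((isClosed_le (by fun_prop) (by fun_prop)).union (isClosed_le (by fun_prop) (by fun_prop)))

lemma isClosed_inBox (A : RectFamily ι) :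
    IsClosed {z : (ι → ℝ) × (ι → ℝ) × ℝ × ℝ | A.InBox z.1 z.2.1 z.2.2.1 z.2.2.2} := by
  simp only [InBox, ofPred_forall, ofPred_and]
  refine isClosed_iInter fun i => ?_
  exact ((isClosed_le (by fun_prop) (by fun_prop)).inter
    (isClosed_le (by fun_prop) (by fun_prop))).inter
    ((isClosed_le (by fun_prop) (by fun_prop)).inter (isClosed_le (by fun_prop) (by fun_prop)))

/-- If the family packs into some box, there is a box of least area into which it packs. -/
lemma PacksIn.exists_min [Nonempty ι] (h : A.PacksIn a b) :
    ∃ a' b', A.PacksIn a' b' ∧ ∀ c d, A.PacksIn c d → a' * b' ≤ c * d := by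
  let i₀ : ι := Classical.arbitrary ι
  -- a bound for the sides of every box of area at most `a * b`
  let M := max (a * b / A.l i₀) (a * b / A.w i₀)
  let top : (ι → ℝ) × (ι → ℝ) × ℝ × ℝ := (fun _ => M, fun _ => M, M, M)
  let K : Set ((ι → ℝ) × (ι → ℝ) × ℝ × ℝ) := Icc 0 top ∩
    ({z | A.InBox z.1 z.2.1 z.2.2.1 z.2.2.2} ∩ {z | A.Separated z.1 z.2.1})
  have hK : IsCompact K :=
    isCompact_Icc.inter_right (A.isClosed_inBox.inter A.isClosed_separated)
  have mem : ∀ {x y : ι → ℝ} {c d : ℝ}, A.InBox x y c d → A.Separated x y → c * d ≤ a * b →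
      (x, y, c, d) ∈ K := by
    intro x y c d hb hs hcd
    have hp : A.PacksIn c d := ⟨x, y, hb, hs⟩
    have hw := A.w_pos i₀
    have hl := A.l_pos i₀
    have hc := hp.w_le i₀
    have hd := hp.l_le i₀
    have hcM : c ≤ M := by
      refine le_trans ?_ (le_max_left _ _)
      rw [le_div_iff₀ hl]
      exact (mul_le_mul_of_nonneg_left hd (by linarith)).trans hcd
    have hdM : d ≤ M := by
      refine le_trans ?_ (le_max_right _ _)
      rw [le_div_iff₀ hw, mul_comm]
      exact (mul_le_mul_of_nonneg_right hc (by linarith)).trans hcd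
    refine ⟨⟨⟨fun i => (hb i).1.1, fun i => (hb i).2.1, ?_, ?_⟩,
      ⟨fun i => ?_, fun i => ?_, hcM, hdM⟩⟩, hb, hs⟩
    · exact hw.le.trans hc
    · exact hl.le.trans hd
    · exact le_trans (by linarith [(hb i).1.2, A.w_pos i]) hcM
    · exact le_trans (by linarith [(hb i).2.2, A.l_pos i]) hdM
  obtain ⟨x, y, hb, hs⟩ := h
  obtain ⟨⟨x', y', a', b'⟩, hz, hmin⟩ := hK.exists_isMinOn ⟨_, mem hb hs le_rfl⟩
    (f := fun z => z.2.2.1 * z.2.2.2) (by fun_prop)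
  refine ⟨a', b', ⟨x', y', hz.2.1, hz.2.2⟩, ?_⟩
  rintro c d ⟨u, v, hb', hs'⟩
  rcases le_total (c * d) (a * b) with hcd | hcd
  · exact hmin (mem hb' hs' hcd)
  · exact (hmin (mem hb hs le_rfl)).trans hcd

lemma PacksIn.isLeast_areas [Nonempty ι] (h : A.PacksIn a b) : IsLeast A.areas A.bestArea := by
  obtain ⟨a', b', hp, hmin⟩ := h.exists_min
  obtain ⟨P, hP, hpa, hqb⟩ := hp.exists_positioning
  let i₀ : ι := Classical.arbitrary ι
  have hp0 : 0 ≤ a' := (A.w_pos i₀).le.trans (hp.w_le i₀)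
  have hq0 : 0 ≤ P.q := (A.l_pos i₀).le.trans (hP.packsIn.l_le i₀)
  have hleast : IsLeast A.areas P.area := by
    refine ⟨⟨P, hP, rfl⟩, ?_⟩
    rintro _ ⟨Q, hQ, rfl⟩
    exact (mul_le_mul hpa hqb hq0 hp0).trans (hmin _ _ hQ.packsIn)
  rw [bestArea, hleast.csInf_eq]
  exact hleast

lemma Positioning.IsBounded.area_pos [Nonempty ι] {P : A.Positioning} (h : P.IsBounded) :
    0 < P.area :=
  let i₀ : ι := Classical.arbitrary ι
  mul_pos ((A.w_pos i₀).trans_le (h.packsIn.w_le i₀)) ((A.l_pos i₀).trans_le (h.packsIn.l_le i₀))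

lemma PacksIn.bestArea_pos [Nonempty ι] (h : A.PacksIn a b) : 0 < A.bestArea := by
  obtain ⟨P, hP, hPa⟩ := h.isLeast_areas.1
  exact hPa ▸ hP.area_pos

lemma PacksIn.bestArea_le [Nonempty ι] (h : A.PacksIn a b) : A.bestArea ≤ a * b := by
  obtain ⟨P, hP, hpa, hqb⟩ := h.exists_positioning
  let i₀ : ι := Classical.arbitrary ι
  exact (h.isLeast_areas.2 ⟨P, hP, rfl⟩).trans (mul_le_mul hpa hqb
    ((A.l_pos i₀).le.trans (hP.packsIn.l_le i₀)) ((A.w_pos i₀).le.trans (h.w_le i₀)))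

lemma totalArea_pos [Nonempty ι] (hS : Summable fun i => A.w i * A.l i) : 0 < A.totalArea :=
  hS.tsum_pos (fun i => (mul_pos (A.w_pos i) (A.l_pos i)).le) (Classical.arbitrary ι)
    (mul_pos (A.w_pos _) (A.l_pos _))

lemma PacksIn.isGreatest_efficiencies [Nonempty ι] (h : A.PacksIn a b) :
    IsGreatest A.efficiencies (A.totalArea / A.bestArea) := by
  have hT := h.isLeast_areas
  have hS : 0 ≤ A.totalArea := tsum_nonneg fun i => (mul_pos (A.w_pos i) (A.l_pos i)).le
  obtain ⟨P, hP, hPa⟩ := hT.1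
  refine ⟨⟨P, hP, by rw [Positioning.efficiency, hPa]⟩, ?_⟩
  rintro _ ⟨Q, hQ, rfl⟩
  exact div_le_div_of_nonneg_left hS h.bestArea_pos (hT.2 ⟨Q, hQ, rfl⟩)

lemma PacksIn.bestEfficiency_eq [Nonempty ι] (h : A.PacksIn a b) :
    A.bestEfficiency = A.totalArea / A.bestArea :=
  h.isGreatest_efficiencies.csSup_eq

lemma Positioning.IsOptimal.area_eq [Nonempty ι] (hS : Summable fun i => A.w i * A.l i)
    {P : A.Positioning} (hP : P.IsOptimal) : P.area = A.bestArea := by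
  have h := hP.2
  rw [hP.1.packsIn.bestEfficiency_eq, Positioning.efficiency, div_eq_mul_inv, div_eq_mul_inv] at h
  exact inv_injective (mul_left_cancel₀ (totalArea_pos hS).ne' h)

/-! ### Shelf packing of squares -/

/-- The greedy shelf packing of squares of sides `s 0, s 1, …` in a strip of width `W`: the
`k`-th value `(x, y, h)` says that the square `k` has its lower left corner at `(x, y)`, on a shelf
of height `h`.  The next square is put on the same shelf if it fits, and otherwise opens a new
shelf, whose height is its side. -/
noncomputable def shelf (s : ℕ → ℝ) (W : ℝ) : ℕ → ℝ × ℝ × ℝ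
  | 0 => (0, 0, s 0)
  | k + 1 =>
    if (shelf s W k).1 + s k + s (k + 1) ≤ W then
      ((shelf s W k).1 + s k, (shelf s W k).2.1, (shelf s W k).2.2)
    else (0, (shelf s W k).2.1 + (shelf s W k).2.2, s (k + 1))

section Shelf

variable {s : ℕ → ℝ} {W : ℝ}

lemma shelf_succ_of_le {k : ℕ} (h : (shelf s W k).1 + s k + s (k + 1) ≤ W) :
    shelf s W (k + 1) = ((shelf s W k).1 + s k, (shelf s W k).2.1, (shelf s W k).2.2) := by
  rw [shelf, if_pos h]

lemma shelf_succ_of_not_le {k : ℕ} (h : ¬ (shelf s W k).1 + s k + s (k + 1) ≤ W) :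
    shelf s W (k + 1) = (0, (shelf s W k).2.1 + (shelf s W k).2.2, s (k + 1)) := by
  rw [shelf, if_neg h]

lemma shelf_bounds (hs : ∀ k, 0 < s k) (ha : Antitone s) (hW : s 0 ≤ W) (k : ℕ) :
    (0 ≤ (shelf s W k).1 ∧ (shelf s W k).1 + s k ≤ W) ∧
      (0 ≤ (shelf s W k).2.1 ∧ s k ≤ (shelf s W k).2.2) := by
  induction k with
  | zero => simp [shelf, hW]
  | succ k ih =>
    obtain ⟨⟨h1, h2⟩, h3, h4⟩ := ih
    have h5 := hs k
    have h6 := ha (Nat.le_succ k)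
    have h7 := ha (Nat.zero_le (k + 1))
    by_cases h : (shelf s W k).1 + s k + s (k + 1) ≤ W
    · rw [shelf_succ_of_le h]
      exact ⟨⟨by dsimp only; linarith, h⟩, h3, h6.trans h4⟩
    · rw [shelf_succ_of_not_le h]
      exact ⟨⟨le_rfl, by dsimp only; linarith⟩, by dsimp only; linarith, le_rfl⟩

/-- A later square is on a higher shelf, or further right on the same shelf. -/
lemma shelf_separated (hs : ∀ k, 0 < s k) (ha : Antitone s) (hW : s 0 ≤ W) {j k : ℕ}
    (hjk : j < k) :
    (shelf s W j).2.1 + (shelf s W j).2.2 ≤ (shelf s W k).2.1 ∨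
      (shelf s W k).2 = (shelf s W j).2 ∧ (shelf s W j).1 + s j ≤ (shelf s W k).1 := by
  have step : ∀ k, (shelf s W (k + 1) = ((shelf s W k).1 + s k, (shelf s W k).2)) ∨
      (shelf s W (k + 1)).2.1 = (shelf s W k).2.1 + (shelf s W k).2.2 := fun k => by
    by_cases h : (shelf s W k).1 + s k + s (k + 1) ≤ W
    · exact Or.inl (shelf_succ_of_le h)
    · exact Or.inr (by rw [shelf_succ_of_not_le h])
  induction k, hjk using Nat.le_induction with
  | base =>
    rcases step j with h | h
    · exact Or.inr (by simp [h])
    · exact Or.inl h.ge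
  | succ k hk ih =>
    have h1 := hs k
    obtain ⟨-, -, h2⟩ := shelf_bounds hs ha hW k
    rcases step k with h | h
    · rw [h]
      rcases ih with ih | ⟨ih, ih'⟩
      · exact Or.inl ih
      · exact Or.inr ⟨ih, by dsimp only; linarith⟩
    · rw [h]
      rcases ih with ih | ⟨ih, ih'⟩
      · exact Or.inl (by linarith)
      · exact Or.inl (by rw [ih])

/-- The height of the shelves is controlled by the areas of the squares.  The term
`s k * (x + s k)`, a lower bound for the area already covered on the current shelf, is what makes
the induction work: it pays for the next shelf when the current one is closed. -/
lemma shelf_height (hs : ∀ k, 0 < s k) (ha : Antitone s) (hW : s 0 ≤ W) (k : ℕ) :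
    ((shelf s W k).2.1 + (shelf s W k).2.2 - s 0) * W + s k * ((shelf s W k).1 + s k) ≤
      2 * ∑ i ∈ Finset.range (k + 1), s i ^ 2 := by
  induction k with
  | zero =>
    simp only [shelf, zero_add, Finset.range_one, Finset.sum_singleton]
    nlinarith [sq_nonneg (s 0)]
  | succ k ih =>
    rw [Finset.sum_range_succ]
    have h5 := hs k
    have h5' := hs (k + 1)
    obtain ⟨⟨h1, -⟩, -, -⟩ := shelf_bounds hs ha hW k
    have h6 : s (k + 1) * ((shelf s W k).1 + s k) ≤ s k * ((shelf s W k).1 + s k) :=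
      mul_le_mul_of_nonneg_right (ha (Nat.le_succ k)) (by linarith)
    by_cases h : (shelf s W k).1 + s k + s (k + 1) ≤ W
    · rw [shelf_succ_of_le h]
      dsimp only
      nlinarith [sq_nonneg (s (k + 1))]
    · rw [shelf_succ_of_not_le h]
      dsimp only
      have h7 : s (k + 1) * W ≤ s (k + 1) * ((shelf s W k).1 + s k + s (k + 1)) :=
        mul_le_mul_of_nonneg_left (not_le.1 h).le h5'.le
      nlinarith

/-- Infinitely many squares of decreasing sides and total area `R` pack into a box
`√R × 4 √R`. -/
lemma exists_square_packing (hs : ∀ k, 0 < s k) (ha : Antitone s)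
    (hsum : Summable fun k => s k ^ 2) :
    ∃ x y : ℕ → ℝ,
      (∀ k, (0 ≤ x k ∧ x k + s k ≤ √(∑' k, s k ^ 2)) ∧
        (0 ≤ y k ∧ y k + s k ≤ 4 * √(∑' k, s k ^ 2))) ∧
      ∀ j k, j < k → x j + s j ≤ x k ∨ y j + s j ≤ y k := by
  have hnn : ∀ i, 0 ≤ s i ^ 2 := fun i => sq_nonneg _
  set R := ∑' k, s k ^ 2
  have hR : √R ^ 2 = R := Real.sq_sqrt (tsum_nonneg hnn)
  have hW : s 0 ≤ √R := Real.le_sqrt_of_sq_le (hsum.le_tsum 0 fun i _ => hnn i)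
  have hW0 : 0 < √R := (hs 0).trans_le hW
  refine ⟨fun k => (shelf s √R k).1, fun k => (shelf s √R k).2.1, fun k => ?_, fun j k hjk => ?_⟩
  · obtain ⟨hx, hy, hh⟩ := shelf_bounds hs ha hW k
    refine ⟨hx, hy, ?_⟩
    have h1 := shelf_height hs ha hW k
    have h2 := hsum.sum_le_tsum (Finset.range (k + 1)) fun i _ => hnn i
    have h3 : 0 ≤ s k * ((shelf s √R k).1 + s k) :=
      mul_nonneg (hs k).le (add_nonneg hx.1 (hs k).le)
    have h4 : ((shelf s √R k).2.1 + (shelf s √R k).2.2 - s 0) * √R ≤ (2 * √R) * √R := by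
      have h5 : (2 * √R) * √R = 2 * R := by linear_combination 2 * hR
      linarith
    have h6 := le_of_mul_le_mul_right h4 hW0
    linarith
  · obtain ⟨-, -, hh⟩ := shelf_bounds hs ha hW j
    rcases shelf_separated hs ha hW hjk with h | h
    · exact Or.inr (by linarith)
    · exact Or.inl h.2

end Shelf

/-! ### Adding and removing the tail of a sequence -/

lemma PacksIn.initial {A : RectFamily ℕ} (h : A.PacksIn a b) (n : ℕ) :
    (A.initial n).PacksIn a b := by
  obtain ⟨x, y, hb, hs⟩ := h
  exact ⟨fun i => x i, fun i => y i, fun i => hb i,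
    fun i j hij => hs i j fun h => hij (Fin.ext h)⟩

/-- If the first `n` rectangles pack into a box `p × q` that is high enough, the remaining ones fit
into a strip of width `√Rₙ` to the right of it. -/
lemma PacksIn.extend {A : RectFamily ℕ} (hC1 : Summable fun i => A.l i ^ 2)
    (hwl : ∀ i, A.w i ≤ A.l i) (hl : Antitone A.l) {n : ℕ} {p q : ℝ} (hp : 0 ≤ p)
    (h : (A.initial n).PacksIn p q) (hq : 4 * √(A.tailSq n) ≤ q) :
    A.PacksIn (p + √(A.tailSq n)) q := by
  obtain ⟨x, y, hb, hs⟩ := h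
  obtain ⟨u, v, hb', hs'⟩ := exists_square_packing (s := fun k => A.l (n + k))
    (fun k => A.l_pos _) (fun i j hij => hl (by omega))
    (hC1.comp_injective (add_right_injective n))
  change ∀ k, (0 ≤ u k ∧ u k + A.l (n + k) ≤ √(A.tailSq n)) ∧
    (0 ≤ v k ∧ v k + A.l (n + k) ≤ 4 * √(A.tailSq n)) at hb'
  change ∀ j k, j < k → u j + A.l (n + j) ≤ u k ∨ v j + A.l (n + j) ≤ v k at hs'
  let X : ℕ → ℝ := fun i => if h : i < n then x ⟨i, h⟩ else p + u (i - n)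
  let Y : ℕ → ℝ := fun i => if h : i < n then y ⟨i, h⟩ else v (i - n)
  have X1 : ∀ i : Fin n, X i = x i := fun i => by simp [X]
  have Y1 : ∀ i : Fin n, Y i = y i := fun i => by simp [Y]
  have X2 : ∀ k, X (n + k) = p + u k := fun k => by simp [X]
  have Y2 : ∀ k, Y (n + k) = v k := fun k => by simp [Y]
  have split : ∀ i : ℕ, (∃ i' : Fin n, i = (i' : ℕ)) ∨ ∃ k, i = n + k := fun i => by
    rcases lt_or_ge i n with h | h
    · exact Or.inl ⟨⟨i, h⟩, rfl⟩
    · exact Or.inr ⟨i - n, by omega⟩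
  have hsep : ∀ i j, i < j → (X i + A.w i ≤ X j ∨ X j + A.w j ≤ X i) ∨
      (Y i + A.l i ≤ Y j ∨ Y j + A.l j ≤ Y i) := by
    intro i j hij
    rcases split i with ⟨i, rfl⟩ | ⟨i, rfl⟩ <;> rcases split j with ⟨j, rfl⟩ | ⟨j, rfl⟩
    · rw [X1, X1, Y1, Y1]
      exact hs i j (by rintro rfl; exact lt_irrefl _ hij)
    · rw [X1, X2]
      have h1 : x i + A.w i ≤ p := (hb i).1.2
      exact Or.inl (Or.inl (by linarith [(hb' j).1.1]))
    · omega
    · rw [X2, X2, Y2, Y2]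
      have h1 := hwl (n + i)
      rcases hs' i j (by omega) with h | h
      · exact Or.inl (Or.inl (by linarith))
      · exact Or.inr (Or.inl h)
  refine ⟨X, Y, fun i => ?_, fun i j hij => ?_⟩
  · rcases split i with ⟨i, rfl⟩ | ⟨k, rfl⟩
    · rw [X1, Y1]
      obtain ⟨⟨h1, h2⟩, h3⟩ := hb i
      exact ⟨⟨h1, h2.trans (le_add_of_nonneg_right (Real.sqrt_nonneg _))⟩, h3⟩
    · rw [X2, Y2]
      obtain ⟨⟨h1, h2⟩, h3, h4⟩ := hb' k
      have h5 := hwl (n + k)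
      exact ⟨⟨by linarith, by linarith⟩, h3, h4.trans hq⟩
  · rcases lt_or_gt_of_ne hij with h | h
    · exact hsep i j h
    · rcases hsep j i h with h | h
      · exact Or.inl h.symm
      · exact Or.inr h.symm

lemma exists_packsIn {A : RectFamily ℕ} (hC1 : Summable fun i => A.l i ^ 2)
    (hwl : ∀ i, A.w i ≤ A.l i) (hl : Antitone A.l) : ∃ a b, A.PacksIn a b := by
  have h0 : (A.initial 0).PacksIn 0 (4 * √(A.tailSq 0)) :=
    ⟨fun _ => 0, fun _ => 0, fun i => i.elim0, fun i => i.elim0⟩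
  exact ⟨_, _, h0.extend hC1 hwl hl le_rfl le_rfl⟩

lemma bestArea_sub_le {A : RectFamily ℕ} (hC1 : Summable fun i => A.l i ^ 2)
    (hwl : ∀ i, A.w i ≤ A.l i) (hl : Antitone A.l) {n : ℕ} (hn : 1 ≤ n)
    {P : (A.initial n).Positioning} (hP : P.IsBounded) (hPa : P.area = (A.initial n).bestArea)
    (hq : 4 * √(A.tailSq n) ≤ P.q) :
    A.bestArea - (A.initial n).bestArea ≤
      (A.initial n).bestArea * √(A.tailSq n) / A.w 0 := by
  have hw : A.w 0 ≤ P.p := hP.packsIn.w_le ⟨0, hn⟩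
  have hw0 := A.w_pos 0
  have h1 := (hP.packsIn.extend hC1 hwl hl (hw0.le.trans hw) hq).bestArea_le
  have hr := Real.sqrt_nonneg (A.tailSq n)
  rw [← hPa, Positioning.area, le_div_iff₀ hw0]
  have hqr : 0 ≤ P.q * √(A.tailSq n) := mul_nonneg (by linarith) hr
  calc (A.bestArea - P.p * P.q) * A.w 0 ≤ (P.q * √(A.tailSq n)) * A.w 0 :=
        mul_le_mul_of_nonneg_right (by linarith) hw0.le
    _ ≤ (P.q * √(A.tailSq n)) * P.p := mul_le_mul_of_nonneg_left hw hqr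
    _ = P.p * P.q * √(A.tailSq n) := by ring

lemma tendsto_sqrt_tailSq (A : RectFamily ℕ) :
    Tendsto (fun n => √(A.tailSq n)) atTop (𝓝 0) := by
  have h := tendsto_sum_nat_add fun i => A.l i ^ 2
  simp only [add_comm _ _, tailSq] at h ⊢
  simpa using h.sqrt

lemma tendsto_totalArea_initial {A : RectFamily ℕ} (hS : Summable fun i => A.w i * A.l i) :
    Tendsto (fun n => (A.initial n).totalArea) atTop (𝓝 A.totalArea) := by
  have h : ∀ n, (A.initial n).totalArea = ∑ i ∈ Finset.range n, A.w i * A.l i := fun n => by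
    rw [totalArea, tsum_fintype, Finset.sum_range]
    rfl
  simp only [h]
  exact hS.hasSum.tendsto_sum_nat

end RectFamily

open RectFamily in
theorem theorem2 (A : RectFamily ℕ)
    (hC1 : Summable fun i => A.l i ^ 2)
    (hwl : ∀ i, A.w i ≤ A.l i)
    (hl : ∀ i, A.l (i + 1) ≤ A.l i) :
    -- the best packing efficiency and the optimal bounding area of `A` are well defined
    -- (finite total area; a positioning of finite extent exists; the sup and inf are attained)
    (Summable fun i => A.w i * A.l i) ∧
    IsGreatest A.efficiencies A.bestEfficiency ∧
    IsLeast A.areas A.bestArea ∧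
    -- a positioning of best efficiency is one of least bounding area
    (∀ P : A.Positioning, P.IsOptimal → P.area = A.bestArea) ∧
    -- and the same for the first `n` rectangles
    (∀ n : ℕ, 1 ≤ n →
      IsGreatest (A.initial n).efficiencies (A.initial n).bestEfficiency ∧
      IsLeast (A.initial n).areas (A.initial n).bestArea ∧
      ∀ P : (A.initial n).Positioning, P.IsOptimal → P.area = (A.initial n).bestArea) ∧
    -- convergence of the best packing efficiencies
    Tendsto (fun n : ℕ => (A.initial n).bestEfficiency) atTop (𝓝 A.bestEfficiency) ∧
    -- the error is nonnegative
    (∀ n : ℕ, 1 ≤ n → (A.initial n).bestArea ≤ A.bestArea) ∧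
    -- the error bound, for all sufficiently large `n`
    (∀ᶠ n : ℕ in atTop,
      A.bestArea - (A.initial n).bestArea
        ≤ (A.initial n).bestArea * √(A.tailSq n) / A.w 0) ∧
    -- more precisely, whenever an optimal positioning of the first `n` rectangles has height at
    -- least `4 √Rₙ`
    (∀ n : ℕ, 1 ≤ n → ∀ P : (A.initial n).Positioning, P.IsOptimal → 4 * √(A.tailSq n) ≤ P.q →
      A.bestArea - (A.initial n).bestArea
        ≤ (A.initial n).bestArea * √(A.tailSq n) / A.w 0) := by
  have hanti : Antitone A.l := antitone_nat_of_succ_le hl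
  obtain ⟨a, b, hA⟩ := exists_packsIn hC1 hwl hanti
  have hS : Summable fun i => A.w i * A.l i :=
    hC1.of_nonneg_of_le (fun i => (mul_pos (A.w_pos i) (A.l_pos i)).le) fun i => by
      rw [sq]
      exact mul_le_mul_of_nonneg_right (hwl i) (A.l_pos i).le
  have hne : ∀ n, 1 ≤ n → Nonempty (Fin n) := fun n hn => ⟨⟨0, hn⟩⟩
  have hleast : ∀ n, 1 ≤ n → IsLeast (A.initial n).areas (A.initial n).bestArea := fun n hn =>
    have := hne n hn
    (hA.initial n).isLeast_areas
  have hopt : ∀ n, 1 ≤ n → ∀ P : (A.initial n).Positioning, P.IsOptimal →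
      P.area = (A.initial n).bestArea := fun n hn P hP =>
    have := hne n hn
    hP.area_eq (Summable.of_finite)
  have hmono : ∀ n, 1 ≤ n → (A.initial n).bestArea ≤ A.bestArea := fun n hn => by
    have := hne n hn
    obtain ⟨P, hP, hPa⟩ := hA.isLeast_areas.1
    exact hPa ▸ (hP.packsIn.initial n).bestArea_le
  have hsqrt := A.tendsto_sqrt_tailSq
  have hbound : ∀ᶠ n : ℕ in atTop, A.bestArea - (A.initial n).bestArea
      ≤ (A.initial n).bestArea * √(A.tailSq n) / A.w 0 := by
    have h4 : Tendsto (fun n => 4 * √(A.tailSq n)) atTop (𝓝 0) := by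
      simpa using hsqrt.const_mul 4
    filter_upwards [h4.eventually_le_const (A.l_pos 0), eventually_ge_atTop 1] with n hn hn1
    obtain ⟨P, hP, hPa⟩ := (hleast n hn1).1
    exact bestArea_sub_le hC1 hwl hanti hn1 hP hPa (hn.trans (hP.packsIn.l_le ⟨0, hn1⟩))
  have hT : Tendsto (fun n => (A.initial n).bestArea) atTop (𝓝 A.bestArea) := by
    have h0 : Tendsto (fun n => A.bestArea - A.bestArea * √(A.tailSq n) / A.w 0) atTop
        (𝓝 A.bestArea) := by
      simpa using ((hsqrt.const_mul A.bestArea).div_const (A.w 0)).const_sub A.bestArea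
    refine tendsto_of_tendsto_of_tendsto_of_le_of_le' h0 tendsto_const_nhds ?_ ?_
    · filter_upwards [hbound, eventually_ge_atTop 1] with n hn hn1
      have h1 : (A.initial n).bestArea * √(A.tailSq n) / A.w 0 ≤
          A.bestArea * √(A.tailSq n) / A.w 0 :=
        div_le_div_of_nonneg_right
          (mul_le_mul_of_nonneg_right (hmono n hn1) (Real.sqrt_nonneg _)) (A.w_pos 0).le
      linarith
    · filter_upwards [eventually_ge_atTop 1] with n hn1 using hmono n hn1
  refine ⟨hS, ?_, hA.isLeast_areas, fun P hP => hP.area_eq hS, fun n hn => ⟨?_, hleast n hn,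
    hopt n hn⟩, ?_, hmono, hbound, fun n hn P hP hq =>
      bestArea_sub_le hC1 hwl hanti hn hP.1 (hopt n hn P hP) hq⟩
  · exact hA.bestEfficiency_eq ▸ hA.isGreatest_efficiencies
  · have := hne n hn
    exact (hA.initial n).bestEfficiency_eq ▸ (hA.initial n).isGreatest_efficiencies
  · rw [hA.bestEfficiency_eq]
    refine ((tendsto_totalArea_initial hS).div hT hA.bestArea_pos.ne').congr' ?_
    filter_upwards [eventually_ge_atTop 1] with n hn
    have := hne n hn
    exact (hA.initial n).bestEfficiency_eq.symm
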